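/- Let $p>3$ be a prime. For a group $H$ write $[h,g]=h^{-1}g^{-1}hg$, and let $\gamma_0(H)=H$ and $\gamma_{i+1}(H)=\langle [h,g]k^p \mid h,k\in\gamma_i(H),\ g\in H\rangle$ be its descending $p$-central series. The $p$-class of a finite $p$-group $H$ is the least $c$ with $\gamma_c(H)=1$. If $G$ is a finite $p$-group of $p$-class $c$, a finite $p$-group $H$ is called a descendant of $G$ if $H/\gamma_c(H)\cong G$ and $H$ and $G$ have the same minimal number of generators; it is an immediate descendant if moreover $H$ has $p$-class $c+1$. The following six groups are, up to isomorphism, exactly the descendants of order $p^5$ of the elementary abelian group $C_p^4$. They are all immediate descendants, and they are pairwise non-isomorphic: $$G_1=\langle g_1,\dots,g_5\mid [g_2,g_1]=g_5\rangle,$$ $$G_2=\langle g_1,\dots,g_5\mid [g_2,g_1]=g_5,\ [g_4,g_3]=g_5\rangle,$$ $$G_3=\langle g_1,\dots,g_5\mid g_1^p=g_5\rangle,$$ $$G_4=\langle g_1,\dots,g_5\mid [g_2,g_1]=g_5,\ g_1^p=g_5\rangle,$$ $$G_5=\langle g_1,\dots,g_5\mid [g_2,g_1]=g_5,\ g_3^p=g_5\rangle,$$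 $$G_6=\langle g_1,\dots,g_5\mid [g_2,g_1]=g_5,\ [g_4,g_3]=g_5,\ g_4^p=g_5\rangle.$$ These are power-commutator presentations: for every $i$ for which no relation for $g_i^p$ is displayed, the relation $g_i^p=1$ is understood, and for every pair $i<j$ for which no relation for $[g_j,g_i]$ is displayed, the relation $[g_j,g_i]=1$ is understood. -/

import Mathlib

namespace PGroupGen

/-- The commutator `[h, g] = h⁻¹ g⁻¹ h g`. -/
def commElt {G : Type*} [Group G] (h g : G) : G := h⁻¹ * g⁻¹ * h * g

/-- The descending `p`-central series: `γ₀(G) = G` and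
`γ_{i+1}(G) = ⟨[h, g] k ^ p | h, k ∈ γ_i(G), g ∈ G⟩`. -/
def pSeries (p : ℕ) (G : Type*) [Group G] : ℕ → Subgroup G
  | 0 => ⊤
  | i + 1 => Subgroup.closure
      {x | ∃ h ∈ pSeries p G i, ∃ k ∈ pSeries p G i, ∃ g : G, x = commElt h g * k ^ p}

instance pSeries_normal (p : ℕ) (G : Type*) [Group G] (i : ℕ) : (pSeries p G i).Normal := by
  induction i with
  | zero => unfold pSeries; infer_instance
  | succ i ih =>
    unfold pSeries
    refine ⟨fun x hx n => ?_⟩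
    induction hx using Subgroup.closure_induction with
    | mem x hx =>
      obtain ⟨h, hh, k, hk, g, rfl⟩ := hx
      refine Subgroup.subset_closure ⟨n * h * n⁻¹, ih.conj_mem h hh n, n * k * n⁻¹,
        ih.conj_mem k hk n, n * g * n⁻¹, ?_⟩
      rw [conj_pow]
      simp only [commElt]
      group
    | one => simp
    | mul x y _ _ hx hy => rw [← conj_mul]; exact mul_mem hx hy
    | inv x _ hx => rw [← conj_inv]; exact inv_mem hx

/-- The `p`-class: the least `c` with `γ_c(G) = 1`. (Such a `c` exists for every finite
`p`-group; the notion is only used for these.) -/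
noncomputable def pClass (p : ℕ) (G : Type*) [Group G] : ℕ :=
  sInf {c | pSeries p G c = ⊥}

/-- `H` is a descendant of `G`: both are finite `p`-groups, `H / γ_c(H) ≅ G` where `c` is the
`p`-class of `G`, and `G` and `H` have the same minimal number of generators. -/
def IsDescendant (p : ℕ) (G H : Type*) [Group G] [Group H] : Prop :=
  ∃ (_ : Finite G) (_ : Finite H), IsPGroup p G ∧ IsPGroup p H ∧
    Nonempty (H ⧸ pSeries p H (pClass p G) ≃* G) ∧ Group.rank H = Group.rank G

/-- An immediate descendant of `G` is a descendant whose `p`-class is one more than that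
of `G`. -/
def IsImmediateDescendant (p : ℕ) (G H : Type*) [Group G] [Group H] : Prop :=
  IsDescendant p G H ∧ pClass p H = pClass p G + 1

/-- The relators of the power-commutator presentation with generators `g_i` (`i : Fin n`) and
relations `g_i ^ p = pw i` for all `i` and `[g_j, g_i] = cm j i` for all `i < j`. -/
def pcRels (p n : ℕ) (pw : Fin n → FreeGroup (Fin n))
    (cm : Fin n → Fin n → FreeGroup (Fin n)) : Set (FreeGroup (Fin n)) :=
  {r | ∃ i, r = FreeGroup.of i ^ p * (pw i)⁻¹} ∪
  {r | ∃ i j, i < j ∧ r = commElt (FreeGroup.of j) (FreeGroup.of i) * (cm j i)⁻¹}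

/-- The generator `g₅`; the generators `g₁, …, g₅` have the indices `0, …, 4`. -/
def g₅ : FreeGroup (Fin 5) := FreeGroup.of 4

/-- Right-hand sides of the power relations of the six groups (groups and generators are
indexed from `0`): `g₁ ^ p = g₅` in the third and the fourth group, `g₃ ^ p = g₅` in the fifth,
`g₄ ^ p = g₅` in the sixth; all other `p`-th powers of generators are trivial. -/
def listPow : Fin 6 → Fin 5 → FreeGroup (Fin 5)
  | 2, 0 => g₅
  | 3, 0 => g₅
  | 4, 2 => g₅
  | 5, 3 => g₅
  | _, _ => 1

/-- Right-hand sides of the commutator relations of the six groups: `[g₂, g₁] = g₅` in all but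
the third group, `[g₄, g₃] = g₅` in the second and the sixth; all other commutators
`[g_j, g_i]`, `i < j`, are trivial. -/
def listComm : Fin 6 → Fin 5 → Fin 5 → FreeGroup (Fin 5)
  | 0, 1, 0 => g₅
  | 1, 1, 0 => g₅
  | 1, 3, 2 => g₅
  | 3, 1, 0 => g₅
  | 4, 1, 0 => g₅
  | 5, 1, 0 => g₅
  | 5, 3, 2 => g₅
  | _, _, _ => 1

/-- The six groups
`⟨g₁, …, g₅ | [g₂, g₁] = g₅⟩`,
`⟨g₁, …, g₅ | [g₂, g₁] = g₅, [g₄, g₃] = g₅⟩`,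
`⟨g₁, …, g₅ | g₁ ^ p = g₅⟩`,
`⟨g₁, …, g₅ | [g₂, g₁] = g₅, g₁ ^ p = g₅⟩`,
`⟨g₁, …, g₅ | [g₂, g₁] = g₅, g₃ ^ p = g₅⟩`,
`⟨g₁, …, g₅ | [g₂, g₁] = g₅, [g₄, g₃] = g₅, g₄ ^ p = g₅⟩`,
in this order, given by power-commutator presentations (trivial relations not written). -/
abbrev listGroup (p : ℕ) (k : Fin 6) : Type :=
  PresentedGroup (pcRels p 5 (listPow k) (listComm k))

/-- The elementary abelian group `C_p ^ 4`. -/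
abbrev ElemAb4 (p : ℕ) : Type := Fin 4 → Multiplicative (ZMod p)

end PGroupGen

/-! Let `H` be a descendant of order `p ^ 5`. Since `C_p ^ 4` has `p`-class 1, the subgroup `γ₁(H)`
has order `p`; being normal in a `p`-group it is central, so `H` is a central extension of `F_p ^ 4`
by `F_p` (`CentralExt`). Commutation then induces an alternating form `ω` on `F_p ^ 4`. As `p` is
odd, taking `p`-th powers induces a linear form `π`, because the correction term is a commutator
raised to `p.choose 2`, a multiple of `p`. The two forms are not both zero, since `γ₁(H) ≠ 1`.

Linear algebra (`exists_isNormalForm`) gives a basis in which `(ω, π)` is one of six pairs: `ω = 0`;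
`ω` of rank 2 with `π` zero, nonzero but zero on the radical, or nonzero on the radical; `ω`
nondegenerate with `π` zero or nonzero. Lifting that basis to `H` yields elements satisfying the
relations of one presented group, hence a surjection from it onto `H`, which is bijective once both
orders are `p ^ 5`.

The order of a presented group is the delicate point. Modulo the central element `g₅` it is exactly
`F_p ^ 4` (`listProj_eq_one_iff`), and `g₅` does not collapse because its image in an explicit group
is nontrivial (`toModel`). The presented groups thus carry the same structure, with forms read off
the relations, and four isomorphism invariants expressed through these forms tell them apart. -/

namespace PGroupGen

open Multiplicative

/-! ### Commutator calculus in class two -/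

section Commutators

variable {G : Type*} [Group G]

theorem mul_commElt (x y : G) : y * x * commElt x y = x * y := by
  simp only [commElt]; group

theorem commElt_eq_one_iff {x y : G} : commElt x y = 1 ↔ Commute x y := by
  rw [← mul_right_inj (y * x), mul_commElt, mul_one]; exact Iff.rfl

theorem map_commElt {H : Type*} [Group H] (f : G →* H) (x y : G) :
    f (commElt x y) = commElt (f x) (f y) := by
  simp [commElt]

theorem inv_commElt (x y : G) : (commElt x y)⁻¹ = commElt y x := by
  simp only [commElt]; group

theorem commElt_mul_left {x y : G} (h : commElt x y ∈ Subgroup.center G) (x' : G) :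
    commElt (x * x') y = commElt x y * commElt x' y := by
  have h1 : commElt (x * x') y = x'⁻¹ * commElt x y * (y⁻¹ * x' * y) := by
    simp only [commElt]; group
  rw [h1, ← (Subgroup.mem_center_iff.1 h x'⁻¹).symm]
  simp only [commElt]; group

theorem commElt_mul_right {x y : G} (h : commElt x y ∈ Subgroup.center G) (y' : G) :
    commElt x (y * y') = commElt x y * commElt x y' := by
  have h1 : commElt x (y * y') = commElt x y' * (y'⁻¹ * commElt x y * y') := by
    simp only [commElt]; group
  rw [h1, Subgroup.mem_center_iff.1 h y'⁻¹, inv_mul_cancel_right,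
    Subgroup.mem_center_iff.1 h]

theorem commElt_pow_right {x y : G} (h : commElt x y ∈ Subgroup.center G) (n : ℕ) :
    commElt x (y ^ n) = commElt x y ^ n := by
  induction n with
  | zero => simp [commElt]
  | succ n ih => rw [pow_succ', commElt_mul_right h, ih, pow_succ']

/-- Collecting the factors `x` to the left moves them past `0, 1, …, n - 1` factors `y`, each
crossing costing one central commutator. -/
theorem mul_pow_of_commElt_mem_center {x y : G} (h : commElt y x ∈ Subgroup.center G) (n : ℕ) :
    (x * y) ^ n = x ^ n * y ^ n * commElt y x ^ n.choose 2 := by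
  induction n with
  | zero => simp
  | succ n ih =>
    have hc : ∀ m : ℕ, ∀ w, w * commElt y x ^ m = commElt y x ^ m * w := fun m w =>
      Subgroup.mem_center_iff.1 (pow_mem h m) w
    have h2 : y ^ n * x = x * y ^ n * commElt y x ^ n := by
      have h3 : commElt (y ^ n) x = commElt y x ^ n := by
        rw [← inv_commElt x (y ^ n), commElt_pow_right, ← inv_commElt y x, inv_pow, inv_inv]
        rw [← inv_commElt]; exact inv_mem h
      rw [← h3, mul_commElt]
    rw [pow_succ, ih, Nat.choose_succ_succ' n 1, Nat.choose_one_right, pow_add (commElt y x), pow_succ x n,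
      pow_succ y n]
    calc x ^ n * y ^ n * commElt y x ^ n.choose 2 * (x * y)
        = x ^ n * (y ^ n * x) * y * commElt y x ^ n.choose 2 := by
          rw [mul_assoc, ← hc]; simp only [mul_assoc]
      _ = _ := by
          rw [h2]
          simp only [mul_assoc]
          rw [← mul_assoc (commElt y x ^ n) y, ← hc n y]
          simp only [mul_assoc]

theorem mul_pow_prime {p : ℕ} (hp : p.Prime) (h2 : 2 < p) {x y : G}
    (h : commElt y x ∈ Subgroup.center G) (h1 : commElt y x ^ p = 1) :
    (x * y) ^ p = x ^ p * y ^ p := by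
  obtain ⟨m, hm⟩ := hp.dvd_choose_self two_ne_zero h2
  rw [mul_pow_of_commElt_mem_center h, hm, pow_mul, h1, one_pow, mul_one]

end Commutators

/-! ### Central extensions and their commutator and power forms -/

/-- A realization of `G` as a central extension of `(ZMod p) ^ 4` by `ZMod p`. -/
structure CentralExt (p : ℕ) (G : Type*) [Group G] where
  proj : G →* Multiplicative (Fin 4 → ZMod p)
  incl : Multiplicative (ZMod p) →* G
  proj_surjective : Function.Surjective proj
  incl_injective : Function.Injective incl
  incl_mem_center : ∀ a, incl a ∈ Subgroup.center G
  proj_eq_one_iff : ∀ x, proj x = 1 ↔ ∃ a, incl a = x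

namespace CentralExt

variable {p : ℕ} {G : Type*} [Group G] (E : CentralExt p G)

@[simp] theorem proj_incl (a) : E.proj (E.incl a) = 1 := (E.proj_eq_one_iff _).2 ⟨a, rfl⟩

theorem incl_pow (a) : E.incl a ^ p = 1 := by
  rw [← map_pow]
  convert E.incl.map_one
  rw [← ofAdd_toAdd a, ← ofAdd_nsmul]
  simp

theorem exists_eq_mul_incl {x y : G} (h : E.proj x = E.proj y) : ∃ a, x = y * E.incl a := by
  obtain ⟨a, ha⟩ := (E.proj_eq_one_iff (y⁻¹ * x)).1 (by simp [h])
  exact ⟨a, by rw [ha, mul_inv_cancel_left]⟩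

/-- The vector underlying an element of the extension. -/
def vec (x : G) : Fin 4 → ZMod p := toAdd (E.proj x)

/-- The central element with a given parameter. -/
def cen (a : ZMod p) : G := E.incl (ofAdd a)

@[simp] theorem vec_mul (x y : G) : E.vec (x * y) = E.vec x + E.vec y := by simp [vec]
@[simp] theorem vec_cen (a) : E.vec (E.cen a) = 0 := by simp [vec, cen]
theorem cen_add (a b) : E.cen (a + b) = E.cen a * E.cen b := by simp [cen]
@[simp] theorem cen_zero : E.cen 0 = 1 := by simp [cen]
theorem cen_natCast (n : ℕ) : E.cen n = E.cen 1 ^ n := by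
  rw [cen, cen, ← map_pow, ← ofAdd_nsmul]; simp
theorem cen_injective : Function.Injective E.cen := fun _ _ h => ofAdd.injective (E.incl_injective h)
theorem cen_mem_center (a) : E.cen a ∈ Subgroup.center G := E.incl_mem_center _
theorem cen_pow (a) : E.cen a ^ p = 1 := E.incl_pow _

theorem vec_surjective : Function.Surjective E.vec := fun v =>
  (E.proj_surjective (ofAdd v)).imp fun x hx => by rw [vec, hx, toAdd_ofAdd]

theorem exists_cen_of_vec_eq_zero {x : G} (h : E.vec x = 0) : ∃ a, E.cen a = x := by
  obtain ⟨a, ha⟩ := (E.proj_eq_one_iff x).1 h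
  exact ⟨toAdd a, ha⟩

theorem exists_eq_mul_cen {x y : G} (h : E.vec x = E.vec y) : ∃ a, x = y * E.cen a := by
  obtain ⟨a, ha⟩ := E.exists_eq_mul_incl (toAdd.injective h)
  exact ⟨toAdd a, ha⟩

theorem exists_commElt_eq (x y : G) : ∃ a, E.cen a = commElt x y := by
  apply E.exists_cen_of_vec_eq_zero
  rw [vec, map_commElt, commElt_eq_one_iff.2 (Commute.all _ _), toAdd_one]

theorem exists_pow_eq (x : G) : ∃ a, E.cen a = x ^ p := by
  apply E.exists_cen_of_vec_eq_zero
  rw [vec, map_pow, toAdd_pow]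
  simp

theorem commElt_mem_center (E : CentralExt p G) (x y : G) : commElt x y ∈ Subgroup.center G := by
  obtain ⟨a, ha⟩ := E.exists_commElt_eq x y
  exact ha ▸ E.cen_mem_center a

theorem mul_pow (E : CentralExt p G) (hp : p.Prime) (h2 : 2 < p) (x y : G) : (x * y) ^ p = x ^ p * y ^ p := by
  obtain ⟨a, ha⟩ := E.exists_commElt_eq y x
  exact mul_pow_prime hp h2 (E.commElt_mem_center y x) (by rw [← ha, E.cen_pow])

theorem commElt_cen_left (a y) : commElt (E.cen a) y = 1 :=
  commElt_eq_one_iff.2 (Subgroup.mem_center_iff.1 (E.cen_mem_center a) y).symm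

theorem commElt_cen_right (a y) : commElt y (E.cen a) = 1 :=
  commElt_eq_one_iff.2 (Subgroup.mem_center_iff.1 (E.cen_mem_center a) y)

theorem exists_commForm : ∃ ω : (Fin 4 → ZMod p) →ₗ[ZMod p] (Fin 4 → ZMod p) →ₗ[ZMod p] ZMod p,
    ∀ x y, E.cen (ω (E.vec x) (E.vec y)) = commElt x y := by
  choose s hs using E.vec_surjective
  choose c hc using E.exists_commElt_eq
  -- Central factors do not change a commutator, so it depends only on the underlying vectors and
  -- any section `s` computes it.
  have key : ∀ x y, c (s (E.vec x)) (s (E.vec y)) = c x y := by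
    intro x y
    obtain ⟨a, ha⟩ := E.exists_eq_mul_cen (hs (E.vec x))
    obtain ⟨b, hb⟩ := E.exists_eq_mul_cen (hs (E.vec y))
    apply E.cen_injective
    rw [hc, hc, ha, hb, commElt_mul_left (E.commElt_mem_center _ _), E.commElt_cen_left, mul_one,
      commElt_mul_right (E.commElt_mem_center _ _), E.commElt_cen_right, mul_one]
  have hl : ∀ v v' w, c (s (v + v')) (s w) = c (s v) (s w) + c (s v') (s w) := by
    intro v v' w
    have h := key (s v * s v') (s w)
    rw [E.vec_mul, hs, hs, hs] at h
    rw [h]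
    apply E.cen_injective
    rw [E.cen_add, hc, hc, hc, commElt_mul_left (E.commElt_mem_center _ _)]
  have hr : ∀ v w w', c (s v) (s (w + w')) = c (s v) (s w) + c (s v) (s w') := by
    intro v w w'
    have h := key (s v) (s w * s w')
    rw [E.vec_mul, hs, hs, hs] at h
    rw [h]
    apply E.cen_injective
    rw [E.cen_add, hc, hc, hc, commElt_mul_right (E.commElt_mem_center _ _)]
  have hsl : ∀ (a : ZMod p) v w, c (s (a • v)) (s w) = a • c (s v) (s w) := fun a v w =>
    ZMod.map_smul (AddMonoidHom.mk' (fun v => c (s v) (s w)) fun v v' => hl v v' w) a v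
  have hsr : ∀ (a : ZMod p) v w, c (s v) (s (a • w)) = a • c (s v) (s w) := fun a v w =>
    ZMod.map_smul (AddMonoidHom.mk' (fun w => c (s v) (s w)) (hr v)) a w
  refine ⟨LinearMap.mk₂ (ZMod p) (fun v w => c (s v) (s w)) hl hsl hr hsr, ?_⟩
  intro x y
  rw [LinearMap.mk₂_apply, key, hc]

theorem exists_powForm (hp : p.Prime) (h2 : 2 < p) :
    ∃ π : (Fin 4 → ZMod p) →ₗ[ZMod p] ZMod p, ∀ x, E.cen (π (E.vec x)) = x ^ p := by
  choose s hs using E.vec_surjective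
  choose c hc using E.exists_pow_eq
  -- A central factor from the kernel has trivial `p`-th power, so `x ^ p` depends only on the
  -- vector of `x`.
  have key : ∀ x, c (s (E.vec x)) = c x := by
    intro x
    obtain ⟨a, ha⟩ := E.exists_eq_mul_cen (hs (E.vec x))
    apply E.cen_injective
    rw [hc, hc, ha, E.mul_pow hp h2, E.cen_pow, mul_one]
  have hl : ∀ v v', c (s (v + v')) = c (s v) + c (s v') := by
    intro v v'
    have h := key (s v * s v')
    rw [E.vec_mul, hs, hs] at h
    rw [h]
    apply E.cen_injective
    rw [E.cen_add, hc, hc, hc, E.mul_pow hp h2]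
  refine ⟨(AddMonoidHom.mk' (fun v => c (s v)) hl).toZModLinearMap p, fun x => ?_⟩
  simp [key, hc]

end CentralExt

/-! ### The relations as powers of the last generator -/

/-- Exponents of the right-hand sides of the power relations. -/
def powExp : Fin 6 → Fin 5 → ℕ
  | 2, 0 => 1
  | 3, 0 => 1
  | 4, 2 => 1
  | 5, 3 => 1
  | _, _ => 0

/-- Exponents of the right-hand sides of the commutator relations. -/
def commExp : Fin 6 → Fin 5 → Fin 5 → ℕ
  | 0, 1, 0 => 1
  | 1, 1, 0 => 1
  | 1, 3, 2 => 1
  | 3, 1, 0 => 1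
  | 4, 1, 0 => 1
  | 5, 1, 0 => 1
  | 5, 3, 2 => 1
  | _, _, _ => 0

theorem listPow_eq (k i) : listPow k i = g₅ ^ powExp k i := by
  unfold listPow powExp; split <;> simp

theorem listComm_eq (k j i) : listComm k j i = g₅ ^ commExp k j i := by
  unfold listComm commExp; split <;> simp

theorem powExp_last (k) : powExp k 4 = 0 := by revert k; decide

theorem commExp_last (k i) : commExp k 4 i = 0 := by revert k i; decide

section Lift

variable {p : ℕ} {k : Fin 6} {G : Type*} [Group G] (h : Fin 5 → G)

/-- The homomorphism determined by five elements satisfying the defining relations. -/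
def listLift (hpow : ∀ i, h i ^ p = h 4 ^ powExp k i)
    (hcomm : ∀ i j, i < j → commElt (h j) (h i) = h 4 ^ commExp k j i) : listGroup p k →* G :=
  PresentedGroup.toGroup (f := h) (by
    rintro r (⟨i, rfl⟩ | ⟨i, j, hij, rfl⟩)
    · rw [listPow_eq]; simp [g₅, hpow]
    · rw [listComm_eq]; simp [g₅, map_commElt, hcomm i j hij])

@[simp] theorem listLift_of (hpow hcomm i) :
    listLift (p := p) (k := k) h hpow hcomm (PresentedGroup.of i) = h i :=
  PresentedGroup.toGroup.of _

end Lift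

/-- The generators of the presented groups. -/
def gen (p : ℕ) (k : Fin 6) (i : Fin 5) : listGroup p k := PresentedGroup.of i

section Relations

variable {p : ℕ} {k : Fin 6}

theorem gen_pow (i) : gen p k i ^ p = gen p k 4 ^ powExp k i := by
  have h : PresentedGroup.mk (pcRels p 5 (listPow k) (listComm k))
      (FreeGroup.of i ^ p * (listPow k i)⁻¹) = 1 :=
    PresentedGroup.one_of_mem (Or.inl ⟨i, rfl⟩)
  rw [listPow_eq] at h
  simp only [g₅, map_mul, map_inv, map_pow] at h
  exact mul_inv_eq_one.1 h

theorem commElt_gen {i j} (hij : i < j) :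
    commElt (gen p k j) (gen p k i) = gen p k 4 ^ commExp k j i := by
  have h : PresentedGroup.mk (pcRels p 5 (listPow k) (listComm k))
      (commElt (FreeGroup.of j) (FreeGroup.of i) * (listComm k j i)⁻¹) = 1 :=
    PresentedGroup.one_of_mem (Or.inr ⟨i, j, hij, rfl⟩)
  rw [listComm_eq] at h
  simp only [g₅, map_mul, map_inv, map_pow, map_commElt] at h
  exact mul_inv_eq_one.1 h

theorem gen_generates (S : Subgroup (listGroup p k)) (h : ∀ i, gen p k i ∈ S) (x) : x ∈ S :=
  PresentedGroup.generated_by _ S h x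

/-- The centralizer of `g₅` contains every generator, since no listed commutator involving `g₅` is
nontrivial. -/
theorem gen_last_mem_center : gen p k 4 ∈ Subgroup.center (listGroup p k) := by
  rw [Subgroup.mem_center_iff]
  intro x
  have := gen_generates (Subgroup.centralizer {gen p k 4}) (fun i => ?_) x
  · exact ((Subgroup.mem_centralizer_singleton_iff).1 this)
  · rw [Subgroup.mem_centralizer_singleton_iff]
    obtain hi | rfl := (Fin.le_last i).lt_or_eq
    · have h := commElt_gen (p := p) (k := k) hi
      change commElt (gen p k 4) _ = _ ^ commExp k 4 i at h
      rw [commExp_last, pow_zero, commElt_eq_one_iff] at h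
      exact h.symm
    · rfl

theorem gen_last_pow : gen p k 4 ^ p = 1 := by
  rw [gen_pow, powExp_last, pow_zero]

end Relations

/-! ### A concrete model in which the last generator survives -/

/-- Multiplication by `p` as a map from `ZMod p` to `ZMod (p ^ 2)`. -/
def mulP (p : ℕ) : ZMod p →+ ZMod (p ^ 2) :=
  ZMod.lift p ⟨zmultiplesHom _ (p : ZMod (p ^ 2)), by
    have : ((p ^ 2 : ℕ) : ZMod (p ^ 2)) = 0 := ZMod.natCast_self _
    simpa [sq] using this⟩

theorem mulP_one (p : ℕ) : mulP p 1 = p := by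
  have := ZMod.lift_coe p ⟨zmultiplesHom _ (p : ZMod (p ^ 2)), by
    have : ((p ^ 2 : ℕ) : ZMod (p ^ 2)) = 0 := ZMod.natCast_self _
    simpa [sq] using this⟩ 1
  simpa [mulP] using this

/-- A central extension of `(ZMod p) ^ 4` by `ZMod (p ^ 2)` in which the images of the generators of
the six groups satisfy the defining relations. -/
@[ext] structure Model (p : ℕ) (c d : ZMod p) where
  v : Fin 4 → ZMod p
  a : ZMod (p ^ 2)

namespace Model

variable {p : ℕ} {c d : ZMod p}

/-- The bilinear cocycle. -/
def cocycle (c d : ZMod p) (v w : Fin 4 → ZMod p) : ZMod p := c * (v 1 * w 0) + d * (v 3 * w 2)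

instance : Mul (Model p c d) := ⟨fun x y => ⟨x.v + y.v, x.a + y.a + mulP p (cocycle c d x.v y.v)⟩⟩
instance : One (Model p c d) := ⟨⟨0, 0⟩⟩
instance : Inv (Model p c d) := ⟨fun x => ⟨-x.v, -x.a + mulP p (cocycle c d x.v x.v)⟩⟩

@[simp] theorem mul_v (x y : Model p c d) : (x * y).v = x.v + y.v := rfl
@[simp] theorem mul_a (x y : Model p c d) :
    (x * y).a = x.a + y.a + mulP p (cocycle c d x.v y.v) := rfl
@[simp] theorem one_v : (1 : Model p c d).v = 0 := rfl
@[simp] theorem one_a : (1 : Model p c d).a = 0 := rfl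
@[simp] theorem inv_v (x : Model p c d) : (x⁻¹).v = -x.v := rfl
@[simp] theorem inv_a (x : Model p c d) :
    (x⁻¹).a = -x.a + mulP p (cocycle c d x.v x.v) := rfl

instance : Group (Model p c d) := Group.ofLeftAxioms
  (fun x y z => by
    ext i
    · simp [add_assoc]
    · simp only [mul_a, mul_v, add_assoc, add_right_inj, ← map_add]
      rw [add_left_comm, add_right_inj, ← map_add]
      congr 1
      simp only [cocycle, Pi.add_apply]; ring)
  (fun x => by ext <;> simp [cocycle])
  (fun x => by
    have h : cocycle c d (-x.v) x.v = -cocycle c d x.v x.v := by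
      simp only [cocycle, Pi.neg_apply]; ring
    ext <;> simp [h])

theorem pow_eq (x : Model p c d) (h : cocycle c d x.v x.v = 0) (n : ℕ) :
    x ^ n = ⟨n • x.v, n • x.a⟩ := by
  induction n with
  | zero => ext <;> simp
  | succ n ih =>
    rw [pow_succ, ih]
    have : cocycle c d (n • x.v) x.v = n * cocycle c d x.v x.v := by
      simp only [cocycle, Pi.smul_apply, nsmul_eq_mul]; ring
    ext
    · simp [add_mul]
    · simp only [mul_a, this, h, mul_zero, map_zero, add_zero, succ_nsmul]

theorem commElt_eq (x y : Model p c d) :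
    commElt x y = ⟨0, mulP p (cocycle c d x.v y.v - cocycle c d y.v x.v)⟩ := by
  rw [← mul_right_inj (y * x), mul_commElt]
  ext
  · simp [add_comm]
  · simp [cocycle, add_comm]

end Model

/-- The vectors underlying the generators. -/
def vecGen (p : ℕ) (i : Fin 5) : Fin 4 → ZMod p :=
  Fin.lastCases 0 (fun i => Pi.single i 1) i

@[simp] theorem vecGen_zero (p : ℕ) : vecGen p 0 = Pi.single 0 1 := rfl
@[simp] theorem vecGen_one (p : ℕ) : vecGen p 1 = Pi.single 1 1 := rfl
@[simp] theorem vecGen_two (p : ℕ) : vecGen p 2 = Pi.single 2 1 := rfl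
@[simp] theorem vecGen_three (p : ℕ) : vecGen p 3 = Pi.single 3 1 := rfl
@[simp] theorem vecGen_four (p : ℕ) : vecGen p 4 = 0 := rfl
theorem vecGen_castSucc (p : ℕ) (i : Fin 4) : vecGen p i.castSucc = Pi.single i 1 := by
  simp [vecGen]

/-- The cocycle is strictly triangular on the generators. On the diagonal this makes `Model.pow_eq`
applicable; off it, only one term of each commutator is left. -/
theorem cocycle_vecGen (p : ℕ) (k : Fin 6) {i j : Fin 5} (hij : i ≤ j) :
    Model.cocycle (commExp k 1 0 : ZMod p) (commExp k 3 2) (vecGen p i) (vecGen p j) = 0 := by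
  fin_cases i <;> fin_cases j <;> first | (simp at hij; done) | simp [Model.cocycle]

theorem cocycle_vecGen' (p : ℕ) (k : Fin 6) {i j : Fin 5} (hij : i < j) :
    Model.cocycle (commExp k 1 0 : ZMod p) (commExp k 3 2) (vecGen p j) (vecGen p i) =
      commExp k j i := by
  fin_cases k <;> fin_cases i <;> fin_cases j <;>
    first | (simp at hij; done) | simp [Model.cocycle, commExp]

/-- The map to the model. -/
noncomputable def toModel (p : ℕ) (k : Fin 6) :
    listGroup p k →* Model p (commExp k 1 0 : ZMod p) (commExp k 3 2) :=
  -- The last generator goes to `p` in `ZMod (p ^ 2)`. A generator with second coordinate `1` then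
  -- has `p`-th power `p`, the image of `g₅`, which is why `ZMod (p ^ 2)` replaces `ZMod p`.
  listLift (fun i => ⟨vecGen p i, if i = 4 then p else powExp k i⟩)
    (fun i => by
      rw [Model.pow_eq _ (cocycle_vecGen p k le_rfl),
        Model.pow_eq _ (cocycle_vecGen p k (le_refl 4))]
      ext
      · simp
      · have : (p : ZMod (p ^ 2)) * p = 0 := by
          rw [← sq, ← Nat.cast_pow]; exact ZMod.natCast_self _
        by_cases hi : i = 4
        · simp [hi, powExp_last, this]
        · simp [hi, mul_comm])
    (fun i j hij => by
      rw [Model.commElt_eq, Model.pow_eq _ (cocycle_vecGen p k (le_refl 4))]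
      ext
      · simp
      · simp only [cocycle_vecGen p k hij.le, cocycle_vecGen' p k hij, sub_zero, if_true]
        rw [← nsmul_one, map_nsmul, mulP_one])

theorem gen_last_ne_one {p : ℕ} (hp : p.Prime) (k : Fin 6) : gen p k 4 ≠ 1 := by
  intro h
  have h1 := congrArg (fun x => (toModel p k x).a) h
  simp only [gen, toModel, listLift_of, if_true, map_one, Model.one_a] at h1
  rw [ZMod.natCast_eq_zero_iff] at h1
  have := Nat.le_of_dvd hp.pos h1
  nlinarith [hp.two_le]

theorem exists_incl {p : ℕ} {G : Type*} [Group G] {z : G} (hz : orderOf z = p) :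
    ∃ f : Multiplicative (ZMod p) →* G, Function.Injective f ∧ f (ofAdd 1) = z ∧
      ∀ x, x ∈ Subgroup.zpowers z ↔ ∃ a, f a = x := by
  have h0 : zmultiplesHom (Additive G) (Additive.ofMul z) p = 0 := by
    rw [zmultiplesHom_apply, natCast_zsmul, ← ofMul_pow, ← hz, pow_orderOf_eq_one, ofMul_one]
  let g := ZMod.lift p ⟨zmultiplesHom (Additive G) (Additive.ofMul z), h0⟩
  have hg : ∀ n : ℤ, g n = Additive.ofMul (z ^ n) := fun n => by
    simp [g]
  refine ⟨AddMonoidHom.toMultiplicativeLeft g, ?_, ?_, ?_⟩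
  · have : Function.Injective g := by
      rw [ZMod.lift_injective]
      intro m hm
      have hm : z ^ m = 1 := hm
      rw [ZMod.intCast_zmod_eq_zero_iff_dvd, ← hz]
      exact orderOf_dvd_iff_zpow_eq_one.2 hm
    exact fun a b h => toAdd.injective (this h)
  · have := hg 1
    simp only [Int.cast_one, zpow_one] at this
    exact this
  · intro x
    rw [Subgroup.mem_zpowers_iff]
    constructor
    · rintro ⟨n, rfl⟩
      exact ⟨ofAdd (n : ZMod p), hg n⟩
    · rintro ⟨a, rfl⟩
      obtain ⟨n, hn⟩ := ZMod.intCast_surjective (toAdd a)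
      refine ⟨n, ?_⟩
      have := hg n
      rw [hn] at this
      exact this.symm

theorem exists_addHom_single {p : ℕ} {A : Type*} [AddCommGroup A] (hA : ∀ y : A, p • y = 0)
    (q : Fin 4 → A) : ∃ f : (Fin 4 → ZMod p) →+ A, ∀ i, f (Pi.single i 1) = q i := by
  let _ := AddCommGroup.zmodModule hA
  refine ⟨(Fintype.linearCombination (ZMod p) q).toAddMonoidHom, fun i => ?_⟩
  simp [Fintype.linearCombination_apply_single]

theorem exists_hom_single {p : ℕ} {Q : Type*} [CommGroup Q] (hQ : ∀ y : Q, y ^ p = 1)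
    (q : Fin 4 → Q) : ∃ f : Multiplicative (Fin 4 → ZMod p) →* Q,
      ∀ i, f (ofAdd (Pi.single i 1)) = q i :=
  let ⟨f, hf⟩ := exists_addHom_single (A := Additive Q) (p := p) hQ fun i => Additive.ofMul (q i)
  ⟨AddMonoidHom.toMultiplicativeLeft f, hf⟩

/-! ### The quotient of a presented group by its last generator -/

section Quotient

variable (p : ℕ) (k : Fin 6)

/-- The map of a presented group to its largest elementary abelian quotient. -/
noncomputable def listProj : listGroup p k →* Multiplicative (Fin 4 → ZMod p) :=
  listLift (fun i => ofAdd (vecGen p i))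
    (fun i => by
      rw [← ofAdd_nsmul, ← ofAdd_nsmul]; simp)
    (fun i j _ => by
      rw [commElt_eq_one_iff.2 (Commute.all _ _), ← ofAdd_nsmul]; simp)

@[simp] theorem listProj_gen (i) : listProj p k (gen p k i) = ofAdd (vecGen p i) :=
  listLift_of _ _ _ _

instance : (Subgroup.zpowers (gen p k 4)).Normal :=
  ⟨by
    rintro _ ⟨n, rfl⟩ g
    have h := Subgroup.mem_center_iff.1 (zpow_mem (gen_last_mem_center (p := p) (k := k)) n) g
    exact ⟨n, by simp only [h, mul_inv_cancel_right]⟩⟩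

theorem quotient_comm (a b : listGroup p k ⧸ Subgroup.zpowers (gen p k 4)) : a * b = b * a := by
  let q := QuotientGroup.mk' (Subgroup.zpowers (gen p k 4))
  have hq : ∀ n : ℕ, q (gen p k 4 ^ n) = 1 := fun n =>
    (QuotientGroup.eq_one_iff _).2 (pow_mem (Subgroup.mem_zpowers _) n)
  have hlt : ∀ i j, i < j → Commute (q (gen p k j)) (q (gen p k i)) := fun i j hij => by
    rw [← commElt_eq_one_iff, ← map_commElt, commElt_gen hij, hq]
  have hij : ∀ i j, Commute (q (gen p k i)) (q (gen p k j)) := fun i j => by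
    rcases lt_trichotomy i j with h | rfl | h
    · exact (hlt i j h).symm
    · exact Commute.refl _
    · exact hlt j i h
  -- Two centralizer passes: everything commutes with each generator, hence with everything.
  have h1 : ∀ j x, Commute (q x) (q (gen p k j)) := fun j x => by
    have := gen_generates ((Subgroup.centralizer {q (gen p k j)}).comap q)
      (fun i => by
        rw [Subgroup.mem_comap, Subgroup.mem_centralizer_singleton_iff]; exact hij i j) x
    rw [Subgroup.mem_comap, Subgroup.mem_centralizer_singleton_iff] at this
    exact this
  have h2 : ∀ y x, Commute (q x) (q y) := fun y x => by
    have := gen_generates ((Subgroup.centralizer {q y}).comap q)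
      (fun i => by
        rw [Subgroup.mem_comap, Subgroup.mem_centralizer_singleton_iff]; exact (h1 i y).symm) x
    rw [Subgroup.mem_comap, Subgroup.mem_centralizer_singleton_iff] at this
    exact this
  obtain ⟨x, rfl⟩ := QuotientGroup.mk'_surjective _ a
  obtain ⟨y, rfl⟩ := QuotientGroup.mk'_surjective _ b
  exact h2 y x

/-- The quotient by `g₅` is abelian of exponent `p`, so `F_p ^ 4` maps to it with the basis going to
the generators. The quotient map therefore factors through `listProj`, which bounds the kernel from
above. -/
theorem listProj_eq_one_iff (x) : listProj p k x = 1 ↔ x ∈ Subgroup.zpowers (gen p k 4) := by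
  constructor
  · intro hx
    let q := QuotientGroup.mk' (Subgroup.zpowers (gen p k 4))
    let _ : CommGroup (listGroup p k ⧸ Subgroup.zpowers (gen p k 4)) :=
      { mul_comm := quotient_comm p k }
    have hpow : ∀ y, q y ^ p = 1 := fun y => by
      have := gen_generates ((powMonoidHom p).comp q).ker (fun i => by
        rw [MonoidHom.mem_ker, MonoidHom.comp_apply, powMonoidHom_apply, ← map_pow, gen_pow]
        exact (QuotientGroup.eq_one_iff _).2 (pow_mem (Subgroup.mem_zpowers _) _)) y
      exact this
    have hpow' : ∀ y : listGroup p k ⧸ Subgroup.zpowers (gen p k 4), y ^ p = 1 := fun y => by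
      obtain ⟨x, rfl⟩ := QuotientGroup.mk'_surjective _ y
      exact hpow x
    obtain ⟨b, hb'⟩ := exists_hom_single hpow' fun i : Fin 4 => q (gen p k i.castSucc)
    have hb : b.comp (listProj p k) = q := by
      apply PresentedGroup.ext
      intro i
      change b (listProj p k (gen p k i)) = q (gen p k i)
      rw [listProj_gen]
      refine Fin.lastCases ?_ (fun i => ?_) i
      · have h1 : vecGen p (Fin.last 4) = 0 := rfl
        rw [h1, ofAdd_zero, map_one]
        exact ((QuotientGroup.eq_one_iff _).2 (Subgroup.mem_zpowers _)).symm
      · rw [vecGen_castSucc, hb']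
    have h3 : q x = 1 := by rw [← hb, MonoidHom.comp_apply, hx, map_one]
    exact (QuotientGroup.eq_one_iff _).1 h3
  · rintro ⟨n, rfl⟩
    simp

theorem listProj_surjective : Function.Surjective (listProj p k) := by
  intro v
  let S : AddSubgroup (Fin 4 → ZMod p) := Subgroup.toAddSubgroup' (listProj p k).range
  have hS : ∀ i, ∀ a : ZMod p, Pi.single i a ∈ S := by
    intro i a
    obtain ⟨n, rfl⟩ := ZMod.intCast_surjective a
    have h1 : Pi.single i (1 : ZMod p) ∈ S := ⟨gen p k i.castSucc, by
      rw [listProj_gen, vecGen_castSucc]; rfl⟩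
    have h2 := S.zsmul_mem h1 n
    rwa [← Pi.single_smul, zsmul_one] at h2
  have : toAdd v ∈ S := by
    rw [← Finset.univ_sum_single (toAdd v)]
    exact S.sum_mem fun i _ => hS i _
  exact this

end Quotient

theorem orderOf_gen_last {p : ℕ} (hp : p.Prime) (k : Fin 6) : orderOf (gen p k 4) = p :=
  have := Fact.mk hp
  orderOf_eq_prime gen_last_pow (gen_last_ne_one hp k)

theorem exists_listExt {p : ℕ} (hp : p.Prime) (k : Fin 6) :
    ∃ E : CentralExt p (listGroup p k), (∀ i, E.vec (gen p k i) = vecGen p i) ∧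
      E.cen 1 = gen p k 4 := by
  obtain ⟨f, hf, h1, hr⟩ := exists_incl (orderOf_gen_last hp k)
  refine ⟨⟨listProj p k, f, listProj_surjective p k, hf, fun a => ?_, fun x => ?_⟩, fun i => ?_, h1⟩
  · obtain ⟨n, hn⟩ := (hr _).2 ⟨a, rfl⟩
    rw [← hn]
    exact zpow_mem gen_last_mem_center n
  · rw [listProj_eq_one_iff, hr]
  · simp [CentralExt.vec]

/-! ### Normal forms of an alternating form together with a linear form -/

section NormalForm

variable {K V : Type*} [Field K] [AddCommGroup V] [Module K V]

/-- Four vectors spanning the whole space. -/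
def Spans (K : Type*) {V : Type*} [Field K] [AddCommGroup V] [Module K V] (x y u w : V) : Prop :=
  ∀ T : Submodule K V, x ∈ T → y ∈ T → u ∈ T → w ∈ T → T = ⊤

theorem Spans.trans {x y u w x' y' u' w' : V} (h : Spans K x y u w)
    (h' : ∀ T : Submodule K V, x' ∈ T → y' ∈ T → u' ∈ T → w' ∈ T →
      x ∈ T ∧ y ∈ T ∧ u ∈ T ∧ w ∈ T) : Spans K x' y' u' w' := fun T h1 h2 h3 h4 =>
  let ⟨a, b, c, d⟩ := h' T h1 h2 h3 h4
  h T a b c d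

theorem exists_span_two [FiniteDimensional K V] {S : Submodule K V} (hS : Module.finrank K S = 2) :
    ∃ u ∈ S, ∃ w ∈ S, ∀ T : Submodule K V, u ∈ T → w ∈ T → S ≤ T := by
  let b := Module.finBasisOfFinrankEq K S hS
  refine ⟨b 0, (b 0).2, b 1, (b 1).2, fun T h0 h1 v hv => ?_⟩
  have h := b.sum_repr ⟨v, hv⟩
  rw [Fin.sum_univ_two] at h
  have h' := congrArg Subtype.val h
  simp only [Submodule.coe_add, Submodule.coe_smul] at h'
  rw [← h']
  exact T.add_mem (T.smul_mem _ h0) (T.smul_mem _ h1)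

theorem exists_span_three [FiniteDimensional K V] {S : Submodule K V}
    (hS : Module.finrank K S = 3) :
    ∃ y ∈ S, ∃ u ∈ S, ∃ w ∈ S, ∀ T : Submodule K V, y ∈ T → u ∈ T → w ∈ T → S ≤ T := by
  let b := Module.finBasisOfFinrankEq K S hS
  refine ⟨b 0, (b 0).2, b 1, (b 1).2, b 2, (b 2).2, fun T h0 h1 h2 v hv => ?_⟩
  have h := b.sum_repr ⟨v, hv⟩
  rw [Fin.sum_univ_three] at h
  have h' := congrArg Subtype.val h
  simp only [Submodule.coe_add, Submodule.coe_smul] at h'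
  rw [← h']
  exact T.add_mem (T.add_mem (T.smul_mem _ h0) (T.smul_mem _ h1)) (T.smul_mem _ h2)

variable (ω : V →ₗ[K] V →ₗ[K] K) (π : V →ₗ[K] K)

/-- A hyperbolic pair of an alternating form can be adapted to a linear form. -/
theorem exists_hyperbolic_adapted (hω : ω.IsAlt) {x y : V} (h : ω y x = 1)
    (hπ : π x ≠ 0 ∨ π y ≠ 0) : ∃ x' y' : V, ω y' x' = 1 ∧ π x' = 0 ∧ π y' = 1 ∧
      (∀ T : Submodule K V, x' ∈ T → y' ∈ T → x ∈ T ∧ y ∈ T) ∧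
      (∀ T : Submodule K V, x ∈ T → y ∈ T → x' ∈ T ∧ y' ∈ T) := by
  have h' : ω x y = -1 := by rw [← hω.neg, h]
  -- In both cases `x'` spans the kernel of `π` on the plane of `x` and `y`, while `y'` is scaled to
  -- `π y' = 1`; the scalars cancel in `ω y' x'`.
  by_cases hy : π y = 0
  · have hx : π x ≠ 0 := by simpa [hy] using hπ
    refine ⟨-π x • y, (π x)⁻¹ • x, ?_, ?_, ?_, ?_, ?_⟩
    · simp [h', hx]
    · simp [hy]
    · simp [hx]
    · intro T h1 h2
      exact ⟨(T.smul_mem_iff (inv_ne_zero hx)).1 h2, (T.smul_mem_iff (neg_ne_zero.2 hx)).1 h1⟩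
    · intro T h1 h2
      exact ⟨T.smul_mem _ h2, T.smul_mem _ h1⟩
  · refine ⟨π y • x - π x • y, (π y)⁻¹ • y, ?_, ?_, ?_, ?_, ?_⟩
    · simp [h, hy, hω y]
    · simp [mul_comm]
    · simp [hy]
    · intro T h1 h2
      have h3 := (T.smul_mem_iff (inv_ne_zero hy)).1 h2
      have h4 := T.add_mem h1 (T.smul_mem (π x) h3)
      rw [sub_add_cancel] at h4
      exact ⟨(T.smul_mem_iff hy).1 h4, h3⟩
    · intro T h1 h2
      exact ⟨T.sub_mem (T.smul_mem _ h1) (T.smul_mem _ h2), T.smul_mem _ h2⟩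

/-- A spanning family with prescribed values of an alternating and a linear form. -/
structure IsNormalForm (k : Fin 6) (b : Fin 4 → V) : Prop where
  spans : Spans K (b 0) (b 1) (b 2) (b 3)
  comm : ∀ i j, i < j → ω (b j) (b i) = commExp k j.castSucc i.castSucc
  pow : ∀ i, π (b i) = powExp k i.castSucc

theorem isNormalForm_mk {k : Fin 6} {x y u w : V} (hs : Spans K x y u w)
    (hyx : ω y x = commExp k 1 0) (hux : ω u x = commExp k 2 0) (huy : ω u y = commExp k 2 1)
    (hwx : ω w x = commExp k 3 0) (hwy : ω w y = commExp k 3 1) (hwu : ω w u = commExp k 3 2)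
    (hx : π x = powExp k 0) (hy : π y = powExp k 1) (hu : π u = powExp k 2)
    (hw : π w = powExp k 3) : IsNormalForm ω π k ![x, y, u, w] where
  spans := hs
  comm i j hij := by
    fin_cases i <;> fin_cases j <;>
      first | (simp at hij; done) | assumption
  pow i := by fin_cases i <;> assumption

theorem exists_isNormalForm_of_nondegenerate (hω : ω.IsAlt) {x y u w : V} (hs : Spans K x y u w)
    (hyx : ω y x = 1) (hux : ω u x = 0) (huy : ω u y = 0)
    (hwx : ω w x = 0) (hwy : ω w y = 0) (hwu : ω w u = 1) :
    ∃ k b, IsNormalForm ω π k b := by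
  have hxy : ω x y = -1 := by rw [← hω.neg, hyx]
  have hxu : ω x u = 0 := by rw [← hω.neg, hux, neg_zero]
  have hyu : ω y u = 0 := by rw [← hω.neg, huy, neg_zero]
  have hxw : ω x w = 0 := by rw [← hω.neg, hwx, neg_zero]
  have hyw : ω y w = 0 := by rw [← hω.neg, hwy, neg_zero]
  have huw : ω u w = -1 := by rw [← hω.neg, hwu]
  by_cases h1 : π x = 0 ∧ π y = 0 <;> by_cases h2 : π u = 0 ∧ π w = 0
  · refine ⟨1, _, isNormalForm_mk ω π hs ?_ ?_ ?_ ?_ ?_ ?_ ?_ ?_ ?_ ?_⟩ <;>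
      simp [commExp, powExp, *]
  · obtain ⟨u', w', hwu', hu', hw', hT, hT'⟩ := exists_hyperbolic_adapted ω π hω hwu (by tauto)
    obtain ⟨a, b⟩ := hT' (LinearMap.ker (ω x)) hxu hxw
    obtain ⟨c, d⟩ := hT' (LinearMap.ker (ω y)) hyu hyw
    rw [LinearMap.mem_ker, ← hω.neg, neg_eq_zero] at a b c d
    refine ⟨5, _, isNormalForm_mk ω π (x := x) (y := y) (u := u') (w := w')
      (hs.trans fun T a b c d => ⟨a, b, hT T c d⟩) ?_ ?_ ?_ ?_ ?_ ?_ ?_ ?_ ?_ ?_⟩ <;>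
      simp [commExp, powExp, *]
  -- Here `π` lives on the first plane only, so the two planes are interchanged.
  · obtain ⟨u', w', hwu', hu', hw', hT, hT'⟩ := exists_hyperbolic_adapted ω π hω hyx (by tauto)
    obtain ⟨a, b⟩ := hT' (LinearMap.ker (ω u)) hux huy
    obtain ⟨c, d⟩ := hT' (LinearMap.ker (ω w)) hwx hwy
    rw [LinearMap.mem_ker, ← hω.neg, neg_eq_zero] at a b c d
    refine ⟨5, _, isNormalForm_mk ω π (x := u) (y := w) (u := u') (w := w')
      (hs.trans fun T a b c d => ⟨(hT T c d).1, (hT T c d).2, a, b⟩)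
      ?_ ?_ ?_ ?_ ?_ ?_ ?_ ?_ ?_ ?_⟩ <;>
      simp [commExp, powExp, *]
  · obtain ⟨u', w', hwu', hu', hw', hT, hT'⟩ := exists_hyperbolic_adapted ω π hω hwu (by tauto)
    obtain ⟨x', y', hyx', hx', hy', hS, hS'⟩ := exists_hyperbolic_adapted ω π hω hyx (by tauto)
    have key : ∀ v, ω v x = 0 → ω v y = 0 → ω v x' = 0 ∧ ω v y' = 0 := fun v h3 h4 =>
      hS' (LinearMap.ker (ω v)) h3 h4
    have key' : ∀ v, ω v u = 0 → ω v w = 0 → ω v u' = 0 ∧ ω v w' = 0 := fun v h3 h4 =>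
      hT' (LinearMap.ker (ω v)) h3 h4
    obtain ⟨a1, a2⟩ := key u hux huy
    obtain ⟨b1, b2⟩ := key w hwx hwy
    obtain ⟨c1, c2⟩ := key' x' (by rw [← hω.neg, a1, neg_zero]) (by rw [← hω.neg, b1, neg_zero])
    obtain ⟨d1, d2⟩ := key' y' (by rw [← hω.neg, a2, neg_zero]) (by rw [← hω.neg, b2, neg_zero])
    have e1 : ω u' x' = 0 := by rw [← hω.neg, c1, neg_zero]
    have e2 : ω w' x' = 0 := by rw [← hω.neg, c2, neg_zero]
    have e3 : ω u' y' = 0 := by rw [← hω.neg, d1, neg_zero]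
    have e4 : ω w' y' = 0 := by rw [← hω.neg, d2, neg_zero]
    have e5 : ω x' y' = -1 := by rw [← hω.neg, hyx']
    have e6 : ω u' w' = -1 := by rw [← hω.neg, hwu']
    have := hω x'; have := hω y'; have := hω u'; have := hω w'
    -- Now `π y' = π w' = 1`. Subtracting `w'` from `y'` kills one value, and adding `x'` to `u'`
    -- restores orthogonality: `ω (u' + x') (y' - w') = -ω u' w' + ω x' y' = 0`.
    refine ⟨5, _, isNormalForm_mk ω π (x := x') (y := y' - w') (u := u' + x') (w := w')
      (hs.trans fun T a b c d => ?_) ?_ ?_ ?_ ?_ ?_ ?_ ?_ ?_ ?_ ?_⟩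
    · have h1 := hS T a ((T.sub_mem_iff_left d).1 b)
      have h2 := hT T ((T.add_mem_iff_left a).1 c) d
      exact ⟨h1.1, h1.2, h2⟩
    all_goals simp [commExp, powExp, *]

theorem exists_isNormalForm_of_rank_two [FiniteDimensional K V] (hω : ω.IsAlt) {x y : V}
    {R : Submodule K V} (hR : Module.finrank K R = 2)
    (hs : ∀ T : Submodule K V, x ∈ T → y ∈ T → R ≤ T → T = ⊤) (hyx : ω y x = 1)
    (hRx : ∀ v ∈ R, ω v x = 0) (hRy : ∀ v ∈ R, ω v y = 0) (hRR : ∀ v ∈ R, ∀ w ∈ R, ω v w = 0) :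
    ∃ k b, IsNormalForm ω π k b := by
  obtain ⟨u, hu, w, hw, hT⟩ := exists_span_two hR
  have hs' : Spans K x y u w := fun T h1 h2 h3 h4 => hs T h1 h2 (hT T h3 h4)
  have hwu := hRR w hw u hu
  have huw := hRR u hu w hw
  have hux := hRx u hu
  have hwx := hRx w hw
  have huy := hRy u hu
  have hwy := hRy w hw
  by_cases h : π u = 0 ∧ π w = 0
  · obtain ⟨h1, h2⟩ := h
    by_cases h' : π x = 0 ∧ π y = 0
    · obtain ⟨h3, h4⟩ := h'
      refine ⟨0, _, isNormalForm_mk ω π hs' ?_ ?_ ?_ ?_ ?_ ?_ ?_ ?_ ?_ ?_⟩ <;>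
        simp [commExp, powExp, *]
    · obtain ⟨x', y', hyx', hx', hy', hS, hS'⟩ :=
        exists_hyperbolic_adapted ω π hω hyx (by tauto)
      obtain ⟨a, b⟩ := hS' (LinearMap.ker (ω u)) hux huy
      obtain ⟨c, d⟩ := hS' (LinearMap.ker (ω w)) hwx hwy
      rw [LinearMap.mem_ker] at a b c d
      have e : ω x' y' = -1 := by rw [← hω.neg, hyx']
      -- In this normal form the first vector carries the value of `π`, so the adapted pair is
      -- rotated; the sign keeps the value of `ω` equal to 1.
      refine ⟨3, _, isNormalForm_mk ω π (x := y') (y := -x') (u := u) (w := w)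
        (hs'.trans fun T h1 h2 h3 h4 =>
          ⟨(hS T (T.neg_mem_iff.1 h2) h1).1, (hS T (T.neg_mem_iff.1 h2) h1).2, h3, h4⟩)
        ?_ ?_ ?_ ?_ ?_ ?_ ?_ ?_ ?_ ?_⟩ <;> simp [commExp, powExp, *]
  · have key : ∀ u w : V, Spans K x y u w → u ∈ R → w ∈ R → π u ≠ 0 →
        ∃ k b, IsNormalForm ω π k b := by
      intro u w hs hu hw h
      have hwu := hRR w hw u hu
      have huu := hRR u hu u hu
      have hux := hRx u hu
      have hwx := hRx w hw
      have huy := hRy u hu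
      have hwy := hRy w hw
      have hxu : ω x u = 0 := by rw [← hω.neg, hux, neg_zero]
      have hyu : ω y u = 0 := by rw [← hω.neg, huy, neg_zero]
      -- Since `u` is in the radical, multiples of it can clear `π` on the other vectors without
      -- affecting `ω`.
      refine ⟨4, _, isNormalForm_mk ω π (x := x - (π x * (π u)⁻¹) • u)
        (y := y - (π y * (π u)⁻¹) • u) (u := (π u)⁻¹ • u) (w := w - (π w * (π u)⁻¹) • u)
        (hs.trans fun T h1 h2 h3 h4 => ?_) ?_ ?_ ?_ ?_ ?_ ?_ ?_ ?_ ?_ ?_⟩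
      · have h5 := (T.smul_mem_iff (inv_ne_zero h)).1 h3
        exact ⟨(T.sub_mem_iff_left (T.smul_mem _ h5)).1 h1,
          (T.sub_mem_iff_left (T.smul_mem _ h5)).1 h2, h5,
          (T.sub_mem_iff_left (T.smul_mem _ h5)).1 h4⟩
      all_goals simp [commExp, powExp, *]
    by_cases h1 : π u = 0
    · exact key w u (hs'.trans fun T a b c d => ⟨a, b, d, c⟩) hw hu fun h2 => h ⟨h1, h2⟩
    · exact key u w hs' hu hw h1

/-- If `ω ≠ 0`, a hyperbolic pair splits off, with an orthogonal complement of dimension 2. On it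
`ω` is either zero (rank 2) or nondegenerate, giving a second hyperbolic pair. -/
theorem exists_isNormalForm [FiniteDimensional K V] (hV : Module.finrank K V = 4) (hω : ω.IsAlt)
    (h0 : ω ≠ 0 ∨ π ≠ 0) : ∃ k b, IsNormalForm ω π k b := by
  by_cases hz : ω = 0
  · have hπ : π ≠ 0 := by tauto
    obtain ⟨x, hx⟩ := π.surjective hπ 1
    have hr := π.finrank_range_add_finrank_ker
    rw [LinearMap.range_eq_top.2 (π.surjective hπ), finrank_top, Module.finrank_self, hV] at hr
    obtain ⟨y, hy, u, hu, w, hw, hT⟩ := exists_span_three (S := LinearMap.ker π) (by omega)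
    rw [LinearMap.mem_ker] at hy hu hw
    refine ⟨2, _, isNormalForm_mk ω π (x := x) (y := y) (u := u) (w := w)
      (fun T h1 h2 h3 h4 => ?_) ?_ ?_ ?_ ?_ ?_ ?_ ?_ ?_ ?_ ?_⟩
    · rw [eq_top_iff]
      intro v _
      have h5 : v - π v • x ∈ T := hT T h2 h3 h4 (by simp [hx])
      exact (T.sub_mem_iff_left (T.smul_mem _ h1)).1 h5
    all_goals simp [commExp, powExp, *]
  · obtain ⟨y, x, hyx⟩ : ∃ y x, ω y x = 1 := by
      obtain ⟨y, hy⟩ : ∃ y, ω y ≠ 0 := by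
        by_contra! h
        exact hz (LinearMap.ext h)
      exact ⟨y, (ω y).surjective hy 1⟩
    have hxy : ω x y = -1 := by rw [← hω.neg, hyx]
    have hxx := hω x
    have hyy := hω y
    let f : V →ₗ[K] K × K := (ω.flip x).prod (ω.flip y)
    have hf : Function.Surjective f := fun ⟨a, b⟩ => ⟨a • y - b • x, by simp [f, *]⟩
    have hr := f.finrank_range_add_finrank_ker
    rw [LinearMap.range_eq_top.2 hf, finrank_top, Module.finrank_prod, Module.finrank_self,
      hV] at hr
    have hR : Module.finrank K (LinearMap.ker f) = 2 := by omega
    have hmem : ∀ v, v ∈ LinearMap.ker f ↔ ω v x = 0 ∧ ω v y = 0 := fun v => by simp [f]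
    have hs : ∀ T : Submodule K V, x ∈ T → y ∈ T → LinearMap.ker f ≤ T → T = ⊤ := by
      intro T h1 h2 h3
      rw [eq_top_iff]
      intro v _
      have h4 : v - (ω v x • y - ω v y • x) ∈ T := h3 (by simp [*])
      exact (T.sub_mem_iff_left (T.sub_mem (T.smul_mem _ h2) (T.smul_mem _ h1))).1 h4
    by_cases hRR : ∀ v ∈ LinearMap.ker f, ∀ w ∈ LinearMap.ker f, ω v w = 0
    · exact exists_isNormalForm_of_rank_two ω π hω hR hs hyx (fun v hv => ((hmem v).1 hv).1)
        (fun v hv => ((hmem v).1 hv).2) hRR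
    · obtain ⟨u, hu, w, hw, hT⟩ := exists_span_two hR
      have hs' : Spans K x y u w := fun T h1 h2 h3 h4 => hs T h1 h2 (hT T h3 h4)
      have hwu : ω w u ≠ 0 := by
        intro h
        have h' : ω u w = 0 := by rw [← hω.neg, h, neg_zero]
        refine hRR fun v hv v' hv' => ?_
        have h3 : ∀ a, ω a u = 0 → ω a w = 0 → ω a v' = 0 := fun a h1 h2 =>
          hT (LinearMap.ker (ω a)) h1 h2 hv'
        exact hT (LinearMap.ker (ω.flip v')) (h3 u (hω u) h') (h3 w h (hω w)) hv
      obtain ⟨hux, huy⟩ := (hmem u).1 hu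
      obtain ⟨hwx, hwy⟩ := (hmem w).1 hw
      refine exists_isNormalForm_of_nondegenerate ω π hω (x := x) (y := y) (u := u)
        (w := (ω w u)⁻¹ • w) (hs'.trans fun T h1 h2 h3 h4 =>
          ⟨h1, h2, h3, (T.smul_mem_iff (inv_ne_zero hwu)).1 h4⟩) ?_ ?_ ?_ ?_ ?_ ?_ <;> simp [*]

end NormalForm

/-! ### The descending central series, the `p`-class and the rank -/

theorem map_mem_pSeries {p : ℕ} {G H : Type*} [Group G] [Group H] (f : G →* H) (i : ℕ) {x : G}
    (hx : x ∈ pSeries p G i) : f x ∈ pSeries p H i := by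
  induction i generalizing x with
  | zero => exact Subgroup.mem_top _
  | succ i ih =>
    have : pSeries p G (i + 1) ≤ (pSeries p H (i + 1)).comap f := by
      rw [pSeries, Subgroup.closure_le]
      rintro _ ⟨h, hh, k, hk, g, rfl⟩
      refine Subgroup.subset_closure ⟨f h, ih hh, f k, ih hk, f g, ?_⟩
      rw [map_mul, map_commElt, map_pow]
    exact this hx

theorem pClass_eq {p c : ℕ} {G : Type*} [Group G] (h : pSeries p G c = ⊥)
    (h' : ∀ i < c, pSeries p G i ≠ ⊥) : pClass p G = c := by
  refine le_antisymm (Nat.sInf_le h) (not_lt.1 fun hlt => h' _ hlt ?_)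
  exact Nat.sInf_mem (s := {c | pSeries p G c = ⊥}) ⟨c, h⟩

theorem pSeries_one_eq_bot {p : ℕ} {G : Type*} [Group G] (hc : ∀ x y : G, Commute x y)
    (hpow : ∀ x : G, x ^ p = 1) : pSeries p G 1 = ⊥ := by
  rw [pSeries, Subgroup.closure_eq_bot_iff]
  rintro _ ⟨h, -, k, -, g, rfl⟩
  rw [commElt_eq_one_iff.2 (hc h g), hpow, mul_one]
  rfl

section ElementaryAbelian

variable (p : ℕ)

theorem pClass_elemAb4 (hp : p.Prime) : pClass p (ElemAb4 p) = 1 := by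
  have := Fact.mk hp
  apply pClass_eq
  · refine pSeries_one_eq_bot (fun x y => Commute.all x y) fun x => ?_
    ext i
    apply toAdd.injective
    simp
  · intro i hi
    obtain rfl : i = 0 := by omega
    rw [pSeries]
    exact top_ne_bot

/-- Componentwise description of `C_p ^ 4`. -/
def elemAb4Equiv : ElemAb4 p ≃* Multiplicative (Fin 4 → ZMod p) where
  toFun v := ofAdd fun i => toAdd (v i)
  invFun w i := ofAdd (toAdd w i)
  left_inv _ := rfl
  right_inv _ := rfl
  map_mul' _ _ := rfl

theorem card_elemAb4 [NeZero p] : Nat.card (ElemAb4 p) = p ^ 4 := by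
  rw [Nat.card_congr (elemAb4Equiv p).toEquiv, Nat.card_congr toAdd, Nat.card_fun]
  simp

/-- A generating set of the group also spans it as a vector space over `ZMod p`. -/
theorem four_le_rank (hp : p.Prime) [Group.FG (ElemAb4 p)] : 4 ≤ Group.rank (ElemAb4 p) := by
  have := Fact.mk hp
  classical
  obtain ⟨S, hS, hcl⟩ := Group.rank_spec (ElemAb4 p)
  let f : ElemAb4 p → Fin 4 → ZMod p := fun v => toAdd (elemAb4Equiv p v)
  have hspan : Submodule.span (ZMod p) (S.image f : Set (Fin 4 → ZMod p)) = ⊤ := by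
    rw [eq_top_iff]
    intro v _
    have h : ∀ x, f x ∈ Submodule.span (ZMod p) (S.image f : Set (Fin 4 → ZMod p)) := by
      intro x
      have hx : x ∈ Subgroup.closure (S : Set (ElemAb4 p)) := hcl ▸ Subgroup.mem_top x
      induction hx using Subgroup.closure_induction with
      | mem x hx => exact Submodule.subset_span (by simpa using ⟨x, hx, rfl⟩)
      | one => exact Submodule.zero_mem _
      | mul x y _ _ hx hy => exact Submodule.add_mem _ hx hy
      | inv x _ hx => exact Submodule.neg_mem _ hx
    exact h ((elemAb4Equiv p).symm (ofAdd v))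
  have h := finrank_span_finset_le_card (R := ZMod p) (S.image f)
  rw [Set.finrank, hspan, finrank_top, Module.finrank_fin_fun] at h
  exact h.trans (Finset.card_image_le.trans hS.le)

end ElementaryAbelian

namespace CentralExt

variable {p : ℕ} {G : Type*} [Group G] (E : CentralExt p G)

theorem mem_ker_iff {x : G} : x ∈ E.proj.ker ↔ E.vec x = 0 := by
  rw [MonoidHom.mem_ker]; exact Iff.rfl

theorem exists_equiv (E : CentralExt p G) : Nonempty ((Fin 4 → ZMod p) × ZMod p ≃ G) := by
  choose s hs using E.vec_surjective
  refine ⟨Equiv.ofBijective (fun v => s v.1 * E.cen v.2) ⟨fun v w h => ?_, fun x => ?_⟩⟩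
  · have h1 := congrArg E.vec h
    simp only [vec_mul, hs, vec_cen, add_zero] at h1
    refine Prod.ext h1 (E.cen_injective ?_)
    simpa [h1] using h
  · obtain ⟨a, ha⟩ := E.exists_eq_mul_cen (hs (E.vec x)).symm
    exact ⟨(E.vec x, a), ha.symm⟩

theorem finite (E : CentralExt p G) [NeZero p] : Finite G := E.exists_equiv.elim fun e => Finite.of_equiv _ e

theorem card_eq (E : CentralExt p G) [NeZero p] : Nat.card G = p ^ 5 := by
  obtain ⟨e⟩ := E.exists_equiv
  rw [← Nat.card_congr e, Nat.card_prod, Nat.card_fun]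
  simp [pow_succ]

theorem pSeries_one_le : pSeries p G 1 ≤ E.proj.ker := by
  rw [pSeries, Subgroup.closure_le]
  rintro _ ⟨h, -, k, -, g, rfl⟩
  obtain ⟨a, ha⟩ := E.exists_commElt_eq h g
  obtain ⟨b, hb⟩ := E.exists_pow_eq k
  rw [SetLike.mem_coe, mem_ker_iff, ← ha, ← hb]
  simp

theorem pSeries_one_eq (h : E.cen 1 ∈ pSeries p G 1) : pSeries p G 1 = E.proj.ker := by
  refine le_antisymm E.pSeries_one_le fun x hx => ?_
  obtain ⟨a, rfl⟩ := E.exists_cen_of_vec_eq_zero (E.mem_ker_iff.1 hx)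
  obtain ⟨n, rfl⟩ := ZMod.intCast_surjective a
  have : E.cen n = E.cen 1 ^ n := by
    rw [cen, cen, ← map_zpow, ← ofAdd_zsmul]; simp
  rw [this]
  exact zpow_mem h n

theorem pSeries_two_eq_bot (E : CentralExt p G) : pSeries p G 2 = ⊥ := by
  rw [pSeries, Subgroup.closure_eq_bot_iff]
  rintro _ ⟨h, hh, k, hk, g, rfl⟩
  obtain ⟨a, rfl⟩ := E.exists_cen_of_vec_eq_zero (E.mem_ker_iff.1 (E.pSeries_one_le hh))
  obtain ⟨b, rfl⟩ := E.exists_cen_of_vec_eq_zero (E.mem_ker_iff.1 (E.pSeries_one_le hk))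
  rw [E.commElt_cen_left, E.cen_pow, mul_one]
  rfl

theorem pClass_eq_two [Fact p.Prime] (h : E.cen 1 ∈ pSeries p G 1) : pClass p G = 2 := by
  have h1 : E.cen 1 ≠ 1 := by
    rw [← E.cen_zero, E.cen_injective.ne_iff]; exact one_ne_zero
  refine pClass_eq E.pSeries_two_eq_bot fun i hi h0 => h1 ?_
  rw [← Subgroup.mem_bot, ← h0]
  interval_cases i
  · exact Subgroup.mem_top _
  · exact h

end CentralExt

/-! ### The six groups are immediate descendants -/

section Descendants

variable {p : ℕ} (hp : p.Prime) (k : Fin 6)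

/-- This both places `g₅` in `γ₁` and makes it redundant as a generator. -/
theorem gen_last_eq : (∃ i : Fin 4, gen p k 4 = gen p k i.castSucc ^ p) ∨
    ∃ i j : Fin 4, gen p k 4 = commElt (gen p k j.castSucc) (gen p k i.castSucc) := by
  have h : (∃ i : Fin 4, powExp k i.castSucc = 1) ∨
      ∃ i j : Fin 4, i < j ∧ commExp k j.castSucc i.castSucc = 1 := by
    revert k; decide
  obtain ⟨i, hi⟩ | ⟨i, j, hij, h⟩ := h
  · exact Or.inl ⟨i, by rw [gen_pow, hi, pow_one]⟩
  · exact Or.inr ⟨i, j, by rw [commElt_gen (Fin.castSucc_lt_castSucc_iff.2 hij), h, pow_one]⟩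

theorem gen_last_mem_pSeries : gen p k 4 ∈ pSeries p (listGroup p k) 1 := by
  rw [pSeries]
  refine Subgroup.subset_closure ?_
  obtain ⟨i, h⟩ | ⟨i, j, h⟩ := gen_last_eq (p := p) k
  · exact ⟨1, one_mem _, _, Subgroup.mem_top (gen p k i.castSucc), 1, by rw [h]; simp [commElt]⟩
  · exact ⟨_, Subgroup.mem_top (gen p k j.castSucc), 1, one_mem _, _, by rw [h, one_pow, mul_one]⟩

theorem rank_listGroup_le [Group.FG (listGroup p k)] : Group.rank (listGroup p k) ≤ 4 := by
  classical
  let S : Finset (listGroup p k) := Finset.univ.image fun i : Fin 4 => gen p k i.castSucc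
  have hS : ∀ i : Fin 4, gen p k i.castSucc ∈ Subgroup.closure (S : Set (listGroup p k)) :=
    fun i => Subgroup.subset_closure (by simp [S])
  have hcl : Subgroup.closure (S : Set (listGroup p k)) = ⊤ := by
    refine (Subgroup.eq_top_iff' _).2 (gen_generates _ fun i => ?_)
    refine Fin.lastCases ?_ hS i
    change gen p k 4 ∈ _
    obtain ⟨i, h⟩ | ⟨i, j, h⟩ := gen_last_eq (p := p) k
    · rw [h]; exact pow_mem (hS i) p
    · rw [h, commElt]
      exact mul_mem (mul_mem (mul_mem (inv_mem (hS j)) (inv_mem (hS i))) (hS j)) (hS i)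
  exact (Group.rank_le hcl).trans (Finset.card_image_le.trans (by simp))

include hp in
theorem isImmediateDescendant_listGroup :
    IsImmediateDescendant p (ElemAb4 p) (listGroup p k) ∧ Nat.card (listGroup p k) = p ^ 5 := by
  have := Fact.mk hp
  obtain ⟨E, -, hz⟩ := exists_listExt hp k
  have hmem : E.cen 1 ∈ pSeries p (listGroup p k) 1 := hz ▸ gen_last_mem_pSeries k
  have := E.finite
  have hcl := pClass_elemAb4 p hp
  have hfin : Finite (ElemAb4 p) := inferInstance
  let q : listGroup p k ⧸ pSeries p (listGroup p k) 1 ≃* ElemAb4 p :=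
    ((QuotientGroup.quotientMulEquivOfEq (E.pSeries_one_eq hmem)).trans
      (QuotientGroup.quotientKerEquivOfSurjective E.proj E.proj_surjective)).trans
      (elemAb4Equiv p).symm
  have hsurj : Function.Surjective ((elemAb4Equiv p).symm.toMonoidHom.comp E.proj) :=
    (elemAb4Equiv p).symm.surjective.comp E.proj_surjective
  refine ⟨⟨⟨hfin, E.finite, IsPGroup.of_card (card_elemAb4 p), IsPGroup.of_card E.card_eq, ?_, ?_⟩,
    ?_⟩, E.card_eq⟩
  · exact ⟨(QuotientGroup.quotientMulEquivOfEq (by rw [hcl])).trans q⟩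
  · exact le_antisymm ((rank_listGroup_le k).trans (four_le_rank p hp))
      (Group.rank_le_of_surjective _ hsurj)
  · rw [E.pClass_eq_two hmem, hcl]

end Descendants

/-! ### Invariants separating the six groups -/

section Invariants

/-- The commutator form in coordinates. -/
def commForm {R : Type*} [CommRing R] (k : Fin 6) (v w : Fin 4 → R) : R :=
  commExp k 1 0 * (v 1 * w 0 - v 0 * w 1) + commExp k 3 2 * (v 3 * w 2 - v 2 * w 3)

/-- The power form in coordinates. -/
def powForm {R : Type*} [CommRing R] (k : Fin 6) (v : Fin 4 → R) : R :=
  powExp k 0 * v 0 + powExp k 1 * v 1 + powExp k 2 * v 2 + powExp k 3 * v 3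

theorem commExp_cross : ∀ k, commExp k 2 0 = 0 ∧ commExp k 2 1 = 0 ∧ commExp k 3 0 = 0 ∧
    commExp k 3 1 = 0 := by decide

theorem commExp_three_two : ∀ k, ¬(k = 1 ∨ k = 5) → commExp k 3 2 = 0 := by decide

theorem eq_sum_single {R : Type*} [CommRing R] (v : Fin 4 → R) :
    v = v 0 • Pi.single 0 1 + v 1 • Pi.single 1 1 + v 2 • Pi.single 2 1 + v 3 • Pi.single 3 1 := by
  ext i; fin_cases i <;> simp

variable {p : ℕ} (hp : p.Prime) (h2 : 2 < p) (k : Fin 6)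

include hp h2 in
theorem exists_listExt_forms : ∃ E : CentralExt p (listGroup p k),
    E.cen 1 ∈ pSeries p (listGroup p k) 1 ∧
    (∀ x y, E.cen (commForm k (E.vec x) (E.vec y)) = commElt x y) ∧
    ∀ x, E.cen (powForm k (E.vec x)) = x ^ p := by
  obtain ⟨E, hvec, hz⟩ := exists_listExt hp k
  obtain ⟨ω, hω⟩ := E.exists_commForm
  obtain ⟨π, hπ⟩ := E.exists_powForm hp h2
  have hlt : ∀ i j, i < j → ω (vecGen p j) (vecGen p i) = commExp k j i := fun i j hij => by
    apply E.cen_injective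
    rw [← hvec, ← hvec, hω, commElt_gen hij, E.cen_natCast, hz]
  have halt : ω.IsAlt := fun v => by
    obtain ⟨x, rfl⟩ := E.vec_surjective v
    apply E.cen_injective
    rw [hω, E.cen_zero, commElt_eq_one_iff]
  have hgt : ∀ i j, i < j → ω (vecGen p i) (vecGen p j) = -commExp k j i := fun i j hij => by
    rw [← halt.neg, hlt i j hij]
  have hpow : ∀ i, π (vecGen p i) = powExp k i := fun i => by
    apply E.cen_injective
    rw [← hvec, hπ, gen_pow, E.cen_natCast, hz]
  refine ⟨E, hz ▸ gen_last_mem_pSeries k, fun x y => ?_, fun x => ?_⟩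
  · rw [← hω]
    congr 1
    obtain ⟨h20, h21, h30, h31⟩ := commExp_cross k
    have a10 := hlt 0 1 (by decide)
    have a20 := hlt 0 2 (by decide)
    have a21 := hlt 1 2 (by decide)
    have a30 := hlt 0 3 (by decide)
    have a31 := hlt 1 3 (by decide)
    have a32 := hlt 2 3 (by decide)
    have b10 := hgt 0 1 (by decide)
    have b20 := hgt 0 2 (by decide)
    have b21 := hgt 1 2 (by decide)
    have b30 := hgt 0 3 (by decide)
    have b31 := hgt 1 3 (by decide)
    have b32 := hgt 2 3 (by decide)
    simp only [h20, h21, h30, h31, vecGen_zero, vecGen_one, vecGen_two, vecGen_three,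
      Nat.cast_zero, neg_zero] at a10 a20 a21 a30 a31 a32 b10 b20 b21 b30 b31 b32
    have c := fun i => halt (Pi.single i 1)
    conv_rhs => rw [eq_sum_single (E.vec x), eq_sum_single (E.vec y)]
    simp only [map_add, map_smul, LinearMap.add_apply, LinearMap.smul_apply, smul_eq_mul, a10, a20,
      a21, a30, a31, a32, b10, b20, b21, b30, b31, b32, c, commForm]
    ring
  · rw [← hπ]
    congr 1
    conv_rhs => rw [eq_sum_single (E.vec x)]
    simp only [map_add, map_smul, smul_eq_mul, ← vecGen_zero, ← vecGen_one, ← vecGen_two,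
      ← vecGen_three, hpow, powForm]
    ring

theorem CentralExt.cen_eq_one_iff {G : Type*} [Group G] (E : CentralExt p G) {a} :
    E.cen a = 1 ↔ a = 0 := by
  rw [← E.cen_zero, E.cen_injective.eq_iff]

variable {k} in
theorem CentralExt.mem_center_iff (E : CentralExt p (listGroup p k))
    (hE : ∀ x y, E.cen (commForm k (E.vec x) (E.vec y)) = commElt x y) (x) :
    x ∈ Subgroup.center (listGroup p k) ↔ ∀ w, commForm k (E.vec x) w = 0 := by
  rw [Subgroup.mem_center_iff, E.vec_surjective.forall]
  refine forall_congr' fun y => ?_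
  rw [← E.cen_eq_one_iff, hE, commElt_eq_one_iff]
  exact ⟨fun h => h.symm, fun h => h.symm⟩

include hp h2

theorem forall_commute_iff : (∀ x y : listGroup p k, x * y = y * x) ↔ k = 2 := by
  have := Fact.mk hp
  obtain ⟨E, -, hω, -⟩ := exists_listExt_forms hp h2 k
  have h : (∀ x y : listGroup p k, x * y = y * x) ↔
      ∀ v w : Fin 4 → ZMod p, commForm k v w = 0 := by
    rw [E.vec_surjective.forall]
    refine forall_congr' fun x => ?_
    rw [E.vec_surjective.forall]
    refine forall_congr' fun y => ?_
    rw [← E.cen_eq_one_iff, hω, commElt_eq_one_iff]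
    exact Iff.rfl
  rw [h]
  constructor
  · intro h
    have := h (Pi.single 1 1) (Pi.single 0 1)
    fin_cases k <;> simp [commForm, commExp] at this ⊢
  · rintro rfl v w
    simp [commForm, commExp]

theorem forall_pow_eq_one_iff : (∀ x : listGroup p k, x ^ p = 1) ↔ k = 0 ∨ k = 1 := by
  have := Fact.mk hp
  obtain ⟨E, -, -, hπ⟩ := exists_listExt_forms hp h2 k
  have h : (∀ x : listGroup p k, x ^ p = 1) ↔ ∀ v : Fin 4 → ZMod p, powForm k v = 0 := by
    rw [E.vec_surjective.forall]
    exact forall_congr' fun x => by rw [← E.cen_eq_one_iff, hπ]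
  rw [h]
  constructor
  · intro h
    -- On the all-ones vector the power form is the sum of the exponents, so any nontrivial power
    -- relation is detected.
    have := h 1
    fin_cases k <;> simp [powForm, powExp] at this ⊢
  · rintro (rfl | rfl) v <;> simp [powForm, powExp]

theorem center_pow_eq_one_iff :
    (∀ x ∈ Subgroup.center (listGroup p k), x ^ p = 1) ↔ k ≠ 2 ∧ k ≠ 4 := by
  have := Fact.mk hp
  obtain ⟨E, -, hω, hπ⟩ := exists_listExt_forms hp h2 k
  have h : (∀ x ∈ Subgroup.center (listGroup p k), x ^ p = 1) ↔
      ∀ v : Fin 4 → ZMod p, (∀ w, commForm k v w = 0) → powForm k v = 0 := by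
    rw [E.vec_surjective.forall]
    exact forall_congr' fun x => by rw [← E.cen_eq_one_iff, hπ, E.mem_center_iff hω]
  rw [h]
  constructor
  · intro h
    constructor <;> rintro rfl
    · have := h (Pi.single 0 1) (fun w => by simp [commForm, commExp])
      simp [powForm, powExp] at this
    · have := h (Pi.single 2 1) (fun w => by simp [commForm, commExp])
      simp [powForm, powExp] at this
  · rintro ⟨h1, h4⟩ v hv
    have a0 := hv (Pi.single 0 1)
    have a1 := hv (Pi.single 1 1)
    have a2 := hv (Pi.single 2 1)
    have a3 := hv (Pi.single 3 1)
    fin_cases k <;> simp_all [powForm, powExp, commForm, commExp]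

theorem center_le_pSeries_iff :
    (∀ x ∈ Subgroup.center (listGroup p k), x ∈ pSeries p (listGroup p k) 1) ↔
      k = 1 ∨ k = 5 := by
  have := Fact.mk hp
  obtain ⟨E, hz, hω, -⟩ := exists_listExt_forms hp h2 k
  have h : (∀ x ∈ Subgroup.center (listGroup p k), x ∈ pSeries p (listGroup p k) 1) ↔
      ∀ v : Fin 4 → ZMod p, (∀ w, commForm k v w = 0) → v = 0 := by
    rw [E.vec_surjective.forall]
    exact forall_congr' fun x => by rw [E.pSeries_one_eq hz, E.mem_ker_iff, E.mem_center_iff hω]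
  rw [h]
  constructor
  · intro h
    by_contra hk
    have h32 := commExp_three_two k hk
    have := h (Pi.single 2 1) (fun w => by simp [commForm, h32])
    simp at this
  · intro hk v hv
    have a0 := hv (Pi.single 0 1)
    have a1 := hv (Pi.single 1 1)
    have a2 := hv (Pi.single 2 1)
    have a3 := hv (Pi.single 3 1)
    ext i
    rcases hk with rfl | rfl <;> fin_cases i <;> simp_all [commForm, commExp]

/-- Four invariants suffice: being abelian, having trivial `p`-th powers, having a center with
trivial `p`-th powers, and having a center inside `γ₁`. No two indices share the same pattern of
answers. -/
theorem eq_of_listGroup_equiv {l : Fin 6} (e : listGroup p k ≃* listGroup p l) : k = l := by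
  have h1 : k = 2 ↔ l = 2 := by
    rw [← forall_commute_iff hp h2 k, ← forall_commute_iff hp h2 l, e.surjective.forall]
    refine forall_congr' fun x => ?_
    rw [e.surjective.forall]
    exact forall_congr' fun y => by rw [← map_mul, ← map_mul, e.injective.eq_iff]
  have hpow : ∀ x, e x ^ p = 1 ↔ x ^ p = 1 := fun x => by
    rw [← map_pow, map_eq_one_iff e e.injective]
  have h3 : (k = 0 ∨ k = 1) ↔ (l = 0 ∨ l = 1) := by
    rw [← forall_pow_eq_one_iff hp h2 k, ← forall_pow_eq_one_iff hp h2 l, e.surjective.forall]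
    simp only [hpow]
  have hcen : ∀ x, e x ∈ Subgroup.center (listGroup p l) ↔ x ∈ Subgroup.center (listGroup p k) := by
    intro x
    rw [Subgroup.mem_center_iff, Subgroup.mem_center_iff, e.surjective.forall]
    exact forall_congr' fun y => by rw [← map_mul, ← map_mul, e.injective.eq_iff]
  have h4 : (k ≠ 2 ∧ k ≠ 4) ↔ (l ≠ 2 ∧ l ≠ 4) := by
    rw [← center_pow_eq_one_iff hp h2 k, ← center_pow_eq_one_iff hp h2 l, e.surjective.forall]
    simp only [hcen, hpow]
  have hser : ∀ x, e x ∈ pSeries p (listGroup p l) 1 ↔ x ∈ pSeries p (listGroup p k) 1 := fun x =>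
    ⟨fun h => by simpa using map_mem_pSeries e.symm.toMonoidHom 1 h,
      map_mem_pSeries e.toMonoidHom 1⟩
  have h5 : (k = 1 ∨ k = 5) ↔ (l = 1 ∨ l = 5) := by
    rw [← center_le_pSeries_iff hp h2 k, ← center_le_pSeries_iff hp h2 l, e.surjective.forall]
    simp only [hcen, hser]
  clear hpow hcen hser e
  revert k l
  decide

end Invariants

/-! ### Every descendant of order `p ^ 5` is in the list -/

section Classification

variable {p : ℕ} {H : Type*} [Group H]

/-- The number of fixed points of conjugation on `N` is divisible by `p`, so besides `1` there is a
fixed point `b ≠ 1`; it is central and generates `N`. -/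
theorem le_center_of_card_prime (hp : p.Prime) [Finite H] (hH : IsPGroup p H) (N : Subgroup H)
    [N.Normal] (hN : Nat.card N = p) : N ≤ Subgroup.center H := by
  have := Fact.mk hp
  have hC : IsPGroup p (ConjAct H) := hH.of_equiv ConjAct.toConjAct
  have : Finite N := inferInstance
  obtain ⟨b, hb, hb1⟩ := hC.exists_fixed_point_of_prime_dvd_card_of_fixed_point N
    (hN ▸ dvd_rfl) (a := 1) (fun g => smul_one g)
  have hbc : (b : H) ∈ Subgroup.center H := by
    rw [Subgroup.mem_center_iff]
    intro g
    have h := congrArg Subtype.val (hb (ConjAct.toConjAct g))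
    rw [ConjAct.Subgroup.val_conj_smul, ConjAct.toConjAct_smul] at h
    rwa [mul_inv_eq_iff_eq_mul] at h
  intro x hx
  obtain ⟨n, hn⟩ := Subgroup.mem_zpowers_iff.1
    (mem_zpowers_of_prime_card hN hb1.symm (g' := ⟨x, hx⟩))
  have : (b : H) ^ n = x := congrArg Subtype.val hn
  exact this ▸ zpow_mem hbc n

theorem exists_centralExt (hp : p.Prime) [Finite H] (hH : IsPGroup p H)
    (e : H ⧸ pSeries p H 1 ≃* ElemAb4 p) (hcard : Nat.card H = p ^ 5) :
    ∃ E : CentralExt p H, E.proj.ker = pSeries p H 1 := by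
  have := Fact.mk hp
  have hN : Nat.card (pSeries p H 1) = p := by
    have h := Subgroup.card_eq_card_quotient_mul_card_subgroup (pSeries p H 1)
    rw [hcard, Nat.card_congr e.toEquiv, card_elemAb4, pow_succ] at h
    exact (Nat.eq_of_mul_eq_mul_left (pow_pos hp.pos 4) h).symm
  have hcen := le_center_of_card_prime hp hH _ hN
  have : Nontrivial (pSeries p H 1) := by
    rw [← Finite.one_lt_card_iff_nontrivial, hN]; exact hp.one_lt
  obtain ⟨z, hz⟩ := exists_ne (1 : pSeries p H 1)
  have hzo : orderOf (z : H) = p := by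
    rw [Subgroup.orderOf_coe]
    have h := orderOf_dvd_natCard z
    rw [hN] at h
    exact ((Nat.dvd_prime hp).1 h).resolve_left fun h1 => hz (orderOf_eq_one_iff.1 h1)
  have hzp : ∀ x, x ∈ Subgroup.zpowers (z : H) ↔ x ∈ pSeries p H 1 := by
    intro x
    constructor
    · rintro ⟨n, rfl⟩
      exact zpow_mem z.2 n
    · intro hx
      obtain ⟨n, hn⟩ := Subgroup.mem_zpowers_iff.1
        (mem_zpowers_of_prime_card hN hz (g' := ⟨x, hx⟩))
      exact ⟨n, congrArg Subtype.val hn⟩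
  obtain ⟨f, hf, -, hr⟩ := exists_incl hzo
  let q : H →* Multiplicative (Fin 4 → ZMod p) :=
    ((elemAb4Equiv p).toMonoidHom.comp e.toMonoidHom).comp (QuotientGroup.mk' (pSeries p H 1))
  have hq : ∀ x, q x = 1 ↔ x ∈ pSeries p H 1 := fun x => by
    change elemAb4Equiv p (e x) = 1 ↔ _
    rw [map_eq_one_iff _ (elemAb4Equiv p).injective, map_eq_one_iff _ e.injective,
      QuotientGroup.eq_one_iff]
  refine ⟨⟨q, f, ?_, hf, fun a => hcen ?_, fun x => ?_⟩, ?_⟩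
  · exact ((elemAb4Equiv p).surjective.comp e.surjective).comp
      (QuotientGroup.mk'_surjective _)
  · rw [← hzp, hr]
    exact ⟨a, rfl⟩
  · rw [hq, ← hzp, hr]
  · ext x
    exact hq x

theorem CentralExt.exists_equiv_listGroup (hp : p.Prime) (h2 : 2 < p) (E : CentralExt p H)
    (hE : E.proj.ker = pSeries p H 1) : ∃ k, Nonempty (H ≃* listGroup p k) := by
  have := Fact.mk hp
  obtain ⟨ω, hω⟩ := E.exists_commForm
  obtain ⟨π, hπ⟩ := E.exists_powForm hp h2
  have halt : ω.IsAlt := fun v => by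
    obtain ⟨x, rfl⟩ := E.vec_surjective v
    apply E.cen_injective
    rw [hω, E.cen_zero, commElt_eq_one_iff]
  have h0 : ω ≠ 0 ∨ π ≠ 0 := by
    by_contra! h
    obtain ⟨rfl, rfl⟩ := h
    have hbot := pSeries_one_eq_bot (p := p) (G := H)
      (fun x y => commElt_eq_one_iff.1 (by rw [← hω]; simp)) (fun x => by rw [← hπ]; simp)
    have h1 : E.cen 1 ∈ E.proj.ker := E.mem_ker_iff.2 (E.vec_cen 1)
    rw [hE, hbot, Subgroup.mem_bot, E.cen_eq_one_iff] at h1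
    exact one_ne_zero h1
  obtain ⟨k, b, hb⟩ := exists_isNormalForm ω π (by simp) halt h0
  choose s hs using E.vec_surjective
  let h : Fin 5 → H := Fin.lastCases (E.cen 1) fun i => s (b i)
  have h4 : h 4 = E.cen 1 := rfl
  have hi : ∀ i : Fin 4, h i.castSucc = s (b i) := fun i => by simp [h]
  have hpow : ∀ i, h i ^ p = h 4 ^ powExp k i := fun i => by
    refine Fin.lastCases ?_ (fun i => ?_) i
    · change h 4 ^ p = h 4 ^ powExp k 4
      rw [powExp_last, h4, E.cen_pow, pow_zero]
    · rw [hi, ← hπ, hs, hb.pow, h4, E.cen_natCast]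
  have hcomm : ∀ i j, i < j → commElt (h j) (h i) = h 4 ^ commExp k j i := fun i j => by
    refine Fin.lastCases (fun _ => ?_) (fun j => ?_) j
    · change commElt (h 4) _ = h 4 ^ commExp k 4 i
      rw [commExp_last, h4, E.commElt_cen_left, pow_zero]
    · refine Fin.lastCases (fun hij => ?_) (fun i hij => ?_) i
      · exact absurd (Fin.le_last _) hij.not_ge
      · rw [hi, hi, ← hω, hs, hs, hb.comm i j (Fin.castSucc_lt_castSucc_iff.1 hij), h4,
          E.cen_natCast]
  let F := listLift h hpow hcomm
  have hF : ∀ i, F (gen p k i) = h i := fun i => listLift_of h hpow hcomm i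
  let T : Submodule (ZMod p) (Fin 4 → ZMod p) :=
    AddSubgroup.toZModSubmodule p (Subgroup.toAddSubgroup' (E.proj.comp F).range)
  have hT : T = ⊤ := by
    have hmem : ∀ i : Fin 4, b i ∈ T := fun i =>
      ⟨gen p k i.castSucc, by
        change E.vec (F (gen p k i.castSucc)) = b i
        rw [hF, hi, hs]⟩
    exact hb.spans T (hmem 0) (hmem 1) (hmem 2) (hmem 3)
  have hsurj : Function.Surjective F := by
    intro x
    obtain ⟨y, hy⟩ : E.vec x ∈ T := hT ▸ Submodule.mem_top
    obtain ⟨a, ha⟩ := E.exists_eq_mul_cen (x := x) (y := F y) hy.symm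
    -- Surjectivity onto vectors leaves only a central discrepancy, corrected by a power of `g₅`.
    refine ⟨y * gen p k 4 ^ a.val, ?_⟩
    rw [map_mul, map_pow, hF, h4, ← E.cen_natCast, ZMod.natCast_zmod_val, ← ha]
  obtain ⟨E', -⟩ := exists_listExt hp k
  have := E'.finite
  have := E.finite
  have hbij : Function.Bijective F :=
    (Nat.bijective_iff_surjective_and_card F).2 ⟨hsurj, by rw [E'.card_eq, E.card_eq]⟩
  exact ⟨k, ⟨(MulEquiv.ofBijective F hbij).symm⟩⟩

end Classification

end PGroupGen

theorem mainTheorem7 (p : ℕ) (hp : p.Prime) (hp3 : 3 < p) :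
    -- the six groups are immediate descendants of order `p ^ 5`,
    (∀ k : Fin 6, PGroupGen.IsImmediateDescendant p (PGroupGen.ElemAb4 p) (PGroupGen.listGroup p k) ∧
      Nat.card (PGroupGen.listGroup p k) = p ^ 5) ∧
    -- they are pairwise non-isomorphic,
    (∀ k l : Fin 6, Nonempty (PGroupGen.listGroup p k ≃* PGroupGen.listGroup p l) → k = l) ∧
    -- and every descendant of order `p ^ 5` is isomorphic to one of them.
    (∀ (H : Type*) [Group H], PGroupGen.IsDescendant p (PGroupGen.ElemAb4 p) H →
      Nat.card H = p ^ 5 → ∃ k : Fin 6, Nonempty (H ≃* PGroupGen.listGroup p k)) := by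
  have h2 : 2 < p := by omega
  refine ⟨fun k => PGroupGen.isImmediateDescendant_listGroup hp k,
    fun k l ⟨e⟩ => PGroupGen.eq_of_listGroup_equiv hp h2 k e, fun H _ h hcard => ?_⟩
  obtain ⟨_, _, -, hH, ⟨e⟩, -⟩ := h
  have hser : PGroupGen.pSeries p H 1 =
      PGroupGen.pSeries p H (PGroupGen.pClass p (PGroupGen.ElemAb4 p)) := by
    rw [PGroupGen.pClass_elemAb4 p hp]
  obtain ⟨E, hE⟩ := PGroupGen.exists_centralExt hp hH
    ((QuotientGroup.quotientMulEquivOfEq hser).trans e) hcard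
  exact E.exists_equiv_listGroup hp h2 hE
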